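/- For every prime $p\ge 5$, $$\sum_{k=0}^{(p-1)/2}\frac{\binom{4k}{2k}\binom{2k}{k}}{(2k+1)\,64^k}\equiv(-1)^{\frac{p-1}{2}}\left(2^{p-1}-\left(2^{p-1}-1\right)^2\right)\pmod{p^3}.$$ Here rational numbers $x,y$ are called congruent modulo $p^3$ if $x-y=p^3\,a/b$ for some integers $a,b$ with $p\nmid b$. -/

import Mathlib

/-- Congruence of rational numbers modulo a natural number `m`, in the usual sense: `x - y` is
`m` times a fraction whose denominator is prime to `m`. -/
def RatModEq (m : ℕ) (x y : ℚ) : Prop :=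
  ∃ a b : ℤ, b ≠ 0 ∧ IsCoprime b (m : ℤ) ∧ x - y = (m : ℚ) * ((a : ℚ) / (b : ℚ))

open Finset

/-! Write N = (p - 1)/2, r = ⌊N/2⌋ and q for the Fermat quotient of 2. The k-th summand is
`chooseProd k (-1/4)` / (2k + 1), and `chooseProd k` is invariant under x ↦ -1 - x, so the sum may
be taken at -1/4 or at -3/4, whichever equals -p/4 + r. After multiplication by 2x + 1, the
truncated sum satisfies a difference equation in x whose increment is a single product
(`truncSum_add_one`). This moves the evaluation point from -p/4 + r to -p/4, where everything
expands in powers of p. With H and H⁽²⁾ the harmonic sums of orders one and two and O_j = 1 + 1/3 +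
... + 1/(2j - 1), `truncSum_neg_cong` and `shiftTerm_cong` give, mod p³, 1/2 + p H_N/2 - (p/2)(H_r +
(p/4) H_r⁽²⁾ + 2p ∑_{j ≤ r} O_j/j). The inputs are H_N ≡ -2q + p q² mod p²
(`harm_half_cong_fermatQ`), H_r + (p/4) H_r⁽²⁾ ≡ -3q + (3/2) p q² mod p² (`harm_quarter_cong`) and ∑
O_j/j ≡ q²/4 mod p (`oddHarmSum_cong`). The result is (1 + pq - p²q²)/2, and 2^(p-1) = 1 + pq. -/

/-- The ring of rational numbers whose denominator is prime to `p`. -/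
def pIntegral (p : ℕ) [hp : Fact p.Prime] : Subring ℚ where
  carrier := {x | ∃ a : ℤ, ∃ b : ℕ, ¬ p ∣ b ∧ x * b = a}
  mul_mem' := by
    rintro x y ⟨a, b, hb, h⟩ ⟨c, d, hd, k⟩
    refine ⟨a * c, b * d, hp.out.not_dvd_mul hb hd, ?_⟩
    push_cast
    rw [← h, ← k]; ring
  one_mem' := ⟨1, 1, hp.out.one_lt.ne' ∘ Nat.dvd_one.mp, by norm_num⟩
  add_mem' := by
    rintro x y ⟨a, b, hb, h⟩ ⟨c, d, hd, k⟩
    refine ⟨a * d + c * b, b * d, hp.out.not_dvd_mul hb hd, ?_⟩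
    push_cast
    rw [← h, ← k]; ring
  zero_mem' := ⟨0, 1, hp.out.one_lt.ne' ∘ Nat.dvd_one.mp, by norm_num⟩
  neg_mem' := by
    rintro x ⟨a, b, hb, h⟩
    exact ⟨-a, b, hb, by push_cast; rw [← h]; ring⟩

/-- Congruence of rational numbers modulo `p ^ n` in the ring of `p`-integral rationals. -/
def PCong (p : ℕ) [Fact p.Prime] (n : ℕ) (x y : ℚ) : Prop :=
  ∃ e ∈ pIntegral p, x - y = (p : ℚ) ^ n * e

/-! ### Arithmetic of p-integral rationals and their congruences. -/

section Basic

variable {p : ℕ} [hp : Fact p.Prime]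

theorem inv_natCast_mem {m : ℕ} (hm : ¬ p ∣ m) : 1 / (m : ℚ) ∈ pIntegral p := by
  refine ⟨1, m, hm, ?_⟩
  have : (m : ℚ) ≠ 0 := by
    rintro h
    exact hm (by rw [Nat.cast_eq_zero.mp h]; exact dvd_zero p)
  field_simp
  norm_num

theorem inv_intCast_mem {m : ℤ} (hm : ¬ (p : ℤ) ∣ m) : 1 / (m : ℚ) ∈ pIntegral p := by
  have h : ¬ p ∣ m.natAbs := fun h => hm (Int.natCast_dvd.mpr h)
  have h2 := inv_natCast_mem h
  rcases Int.natAbs_eq m with h3 | h3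
  · rw [h3, Int.cast_natCast]; exact h2
  · rw [h3, Int.cast_neg, Int.cast_natCast, div_neg]; exact neg_mem h2

theorem inv_two_pow_mem (h2 : p ≠ 2) (k : ℕ) : 1 / (2 : ℚ) ^ k ∈ pIntegral p := by
  have := inv_natCast_mem (p := p) (m := 2 ^ k) fun h =>
    h2 ((Nat.prime_dvd_prime_iff_eq hp.out Nat.prime_two).mp (hp.out.dvd_of_dvd_pow h))
  simpa using this

theorem div_two_mem (h2 : p ≠ 2) {x : ℚ} (hx : x ∈ pIntegral p) : x / 2 ∈ pIntegral p := by
  have := mul_mem hx (inv_two_pow_mem h2 1)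
  convert this using 1; ring

theorem div_four_mem (h2 : p ≠ 2) {x : ℚ} (hx : x ∈ pIntegral p) : x / 4 ∈ pIntegral p := by
  have := mul_mem hx (inv_two_pow_mem h2 2)
  convert this using 1; ring

theorem div_eight_mem (h2 : p ≠ 2) {x : ℚ} (hx : x ∈ pIntegral p) : x / 8 ∈ pIntegral p := by
  have := mul_mem hx (inv_two_pow_mem h2 3)
  convert this using 1; ring

theorem div_sixteen_mem (h2 : p ≠ 2) {x : ℚ} (hx : x ∈ pIntegral p) :
    x / 16 ∈ pIntegral p := by
  have := mul_mem hx (inv_two_pow_mem h2 4)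
  convert this using 1; ring

namespace PCong

variable {n : ℕ} {x y z w c : ℚ}

theorem of_eq (h : x = y) : PCong p n x y := ⟨0, zero_mem _, by rw [h]; ring⟩

theorem refl (x : ℚ) : PCong p n x x := of_eq rfl

theorem symm (h : PCong p n x y) : PCong p n y x := by
  obtain ⟨e, he, h⟩ := h
  exact ⟨-e, neg_mem he, by linear_combination -h⟩

theorem trans (h : PCong p n x y) (h' : PCong p n y z) : PCong p n x z := by
  obtain ⟨e, he, h⟩ := h
  obtain ⟨f, hf, h'⟩ := h'
  exact ⟨e + f, add_mem he hf, by linear_combination h + h'⟩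

theorem add (h : PCong p n x y) (h' : PCong p n z w) : PCong p n (x + z) (y + w) := by
  obtain ⟨e, he, h⟩ := h
  obtain ⟨f, hf, h'⟩ := h'
  exact ⟨e + f, add_mem he hf, by linear_combination h + h'⟩

theorem neg (h : PCong p n x y) : PCong p n (-x) (-y) := by
  obtain ⟨e, he, h⟩ := h
  exact ⟨-e, neg_mem he, by linear_combination -h⟩

theorem sub (h : PCong p n x y) (h' : PCong p n z w) : PCong p n (x - z) (y - w) := by
  rw [sub_eq_add_neg, sub_eq_add_neg]
  exact h.add h'.neg

theorem mul_left (hc : c ∈ pIntegral p) (h : PCong p n x y) : PCong p n (c * x) (c * y) := by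
  obtain ⟨e, he, h⟩ := h
  exact ⟨c * e, mul_mem hc he, by linear_combination c * h⟩

theorem mem_iff (h : PCong p n x y) : x ∈ pIntegral p ↔ y ∈ pIntegral p := by
  obtain ⟨e, he, h⟩ := h
  have h1 : (p : ℚ) ^ n * e ∈ pIntegral p := mul_mem (pow_mem (natCast_mem _ p) n) he
  constructor
  · intro hx
    have := sub_mem hx h1
    rwa [← h, sub_sub_cancel] at this
  · intro hy
    have := add_mem hy h1
    rwa [← h, add_sub_cancel] at this

theorem mul (hx : x ∈ pIntegral p) (hw : w ∈ pIntegral p) (h : PCong p n x y)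
    (h' : PCong p n z w) : PCong p n (x * z) (y * w) := by
  refine (h'.mul_left hx).trans ?_
  rw [mul_comm x, mul_comm y]
  exact h.mul_left hw

theorem sum {ι : Type*} {s : Finset ι} {f g : ι → ℚ} (h : ∀ i ∈ s, PCong p n (f i) (g i)) :
    PCong p n (∑ i ∈ s, f i) (∑ i ∈ s, g i) := by
  classical
  induction s using Finset.induction_on with
  | empty => simpa using refl 0
  | insert a s ha ih =>
    rw [sum_insert ha, sum_insert ha]
    exact (h a (mem_insert_self a s)).add (ih fun i hi => h i (mem_insert_of_mem hi))

theorem mono {m : ℕ} (hm : m ≤ n) (h : PCong p n x y) : PCong p m x y := by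
  obtain ⟨e, he, h⟩ := h
  refine ⟨(p : ℚ) ^ (n - m) * e, mul_mem (pow_mem (natCast_mem _ p) _) he, ?_⟩
  rw [h, ← mul_assoc, ← pow_add, Nat.add_sub_cancel' hm]

theorem prime_mul (h : PCong p n x y) : PCong p (n + 1) (p * x) (p * y) := by
  obtain ⟨e, he, h⟩ := h
  exact ⟨e, he, by linear_combination (p : ℚ) * h⟩

theorem of_prime_mul (h : PCong p (n + 1) (p * x) (p * y)) : PCong p n x y := by
  obtain ⟨e, he, h⟩ := h
  refine ⟨e, he, ?_⟩
  have hp0 : (p : ℚ) ≠ 0 := Nat.cast_ne_zero.mpr hp.out.ne_zero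
  apply mul_left_cancel₀ hp0
  linear_combination h

theorem congr (h : PCong p n x y) (h' : z - w = x - y) : PCong p n z w := by
  obtain ⟨e, he, h⟩ := h
  exact ⟨e, he, h'.trans h⟩

theorem toRatModEq (h : PCong p n x y) : RatModEq (p ^ n) x y := by
  obtain ⟨e, ⟨a, b, hb, hab⟩, h⟩ := h
  have hb0 : b ≠ 0 := by rintro rfl; exact hb (dvd_zero p)
  refine ⟨a, b, by exact_mod_cast hb0, ?_, ?_⟩
  · rw [Nat.isCoprime_iff_coprime]
    exact ((Nat.Prime.coprime_iff_not_dvd hp.out).mpr hb).symm.pow_right n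
  · rw [h, ← hab]
    have : (b : ℚ) ≠ 0 := by exact_mod_cast hb0
    push_cast
    field_simp

/-- Second-order expansion of `∏ (1 + p f)`. -/
theorem prod_one_add {ι : Type*} (h2 : p ≠ 2) (s : Finset ι) (f : ι → ℚ)
    (hf : ∀ i ∈ s, f i ∈ pIntegral p) :
    PCong p 3 (∏ i ∈ s, (1 + p * f i))
      (1 + p * ∑ i ∈ s, f i + p ^ 2 * ((∑ i ∈ s, f i) ^ 2 - ∑ i ∈ s, f i ^ 2) / 2) := by
  classical
  induction s using Finset.induction_on with
  | empty => exact of_eq (by simp)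
  | insert a s ha ih =>
    have hs : ∀ i ∈ s, f i ∈ pIntegral p := fun i hi => hf i (mem_insert_of_mem hi)
    have hfa := hf a (mem_insert_self a s)
    have h1 := sum_mem hs
    have h3 := sum_mem fun i hi => pow_mem (hs i hi) 2
    rw [prod_insert ha, sum_insert ha, sum_insert ha]
    refine ((ih hs).mul_left (c := 1 + p * f a)
      (add_mem (one_mem _) (mul_mem (natCast_mem _ p) hfa))).trans ?_
    refine ⟨f a * (((∑ i ∈ s, f i) ^ 2 - ∑ i ∈ s, f i ^ 2) / 2),
      mul_mem hfa (div_two_mem h2 (sub_mem (pow_mem h1 2) h3)), ?_⟩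
    ring

/-- First-order expansion of `∏ (1 + p f)`. -/
theorem prod_one_add' {ι : Type*} (s : Finset ι) (f : ι → ℚ)
    (hf : ∀ i ∈ s, f i ∈ pIntegral p) :
    PCong p 2 (∏ i ∈ s, (1 + p * f i)) (1 + p * ∑ i ∈ s, f i) := by
  classical
  induction s using Finset.induction_on with
  | empty => exact of_eq (by simp)
  | insert a s ha ih =>
    have hs : ∀ i ∈ s, f i ∈ pIntegral p := fun i hi => hf i (mem_insert_of_mem hi)
    have hfa := hf a (mem_insert_self a s)
    rw [prod_insert ha, sum_insert ha]
    refine ((ih hs).mul_left (c := 1 + p * f a)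
      (add_mem (one_mem _) (mul_mem (natCast_mem _ p) hfa))).trans ?_
    exact ⟨f a * ∑ i ∈ s, f i, mul_mem hfa (sum_mem hs), by ring⟩

end PCong

end Basic

/-! ### Harmonic sums and their exact identities. -/

/-- The harmonic numbers. -/
def harm (n : ℕ) : ℚ := ∑ i ∈ range n, 1 / ((i : ℚ) + 1)

/-- The harmonic numbers of order two. -/
def harmSq (n : ℕ) : ℚ := ∑ i ∈ range n, (1 / ((i : ℚ) + 1)) ^ 2

/-- Sums of reciprocals of the first odd numbers. -/
def oddHarm (n : ℕ) : ℚ := ∑ i ∈ range n, 1 / (2 * (i : ℚ) + 1)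

/-- Sums of squared reciprocals of the first odd numbers. -/
def oddHarmSq (n : ℕ) : ℚ := ∑ i ∈ range n, (1 / (2 * (i : ℚ) + 1)) ^ 2

theorem harm_succ (n : ℕ) : harm (n + 1) = harm n + 1 / ((n : ℚ) + 1) := sum_range_succ _ _

theorem harmSq_succ (n : ℕ) : harmSq (n + 1) = harmSq n + (1 / ((n : ℚ) + 1)) ^ 2 :=
  sum_range_succ _ _

theorem oddHarm_succ (n : ℕ) : oddHarm (n + 1) = oddHarm n + 1 / (2 * (n : ℚ) + 1) :=
  sum_range_succ _ _

theorem sum_range_two_mul (f : ℕ → ℚ) (n : ℕ) :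
    ∑ i ∈ range (2 * n), f i = ∑ i ∈ range n, (f (2 * i) + f (2 * i + 1)) := by
  induction n with
  | zero => simp
  | succ n ih =>
    rw [show 2 * (n + 1) = 2 * n + 1 + 1 by ring, sum_range_succ, sum_range_succ, ih,
      sum_range_succ]
    ring

theorem sum_range_two_mul_reflect (f : ℕ → ℚ) (n : ℕ) :
    ∑ i ∈ range (2 * n), f i = ∑ i ∈ range n, (f i + f (2 * n - 1 - i)) := by
  rw [two_mul, sum_range_add, sum_add_distrib, ← sum_range_reflect (fun i => f (n + i))]
  congr 1
  refine sum_congr rfl fun i hi => congrArg f ?_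
  have := mem_range.mp hi
  omega

theorem harm_two_mul (n : ℕ) : harm (2 * n) = oddHarm n + harm n / 2 := by
  rw [harm, sum_range_two_mul, sum_add_distrib, oddHarm, harm, sum_div]
  congr 1 <;> refine sum_congr rfl fun i _ => ?_
  · push_cast; ring
  · have : (i : ℚ) + 1 ≠ 0 := by positivity
    push_cast
    rw [show 2 * (i : ℚ) + 1 + 1 = 2 * (i + 1) by ring]
    field_simp

theorem harmSq_two_mul (n : ℕ) : harmSq (2 * n) = oddHarmSq n + harmSq n / 4 := by
  rw [harmSq, sum_range_two_mul, sum_add_distrib, oddHarmSq, harmSq, sum_div]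
  congr 1 <;> refine sum_congr rfl fun i _ => ?_
  · push_cast; ring
  · have : (i : ℚ) + 1 ≠ 0 := by positivity
    push_cast
    rw [show 2 * (i : ℚ) + 1 + 1 = 2 * (i + 1) by ring]
    field_simp
    norm_num

theorem sum_alternating_inv (n : ℕ) :
    ∑ i ∈ range (2 * n), (-1 : ℚ) ^ i * (1 / ((i : ℚ) + 1)) = oddHarm n - harm n / 2 := by
  rw [sum_range_two_mul, sum_add_distrib, oddHarm, harm, sum_div, sub_eq_add_neg,
    ← sum_neg_distrib]
  congr 1 <;> refine sum_congr rfl fun i _ => ?_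
  · simp
  · have : (i : ℚ) + 1 ≠ 0 := by positivity
    rw [pow_succ, pow_mul]
    push_cast
    rw [show 2 * (i : ℚ) + 1 + 1 = 2 * (i + 1) by ring]
    field_simp
    norm_num

theorem inv_reflect {p N : ℕ} (hN : p = 2 * N + 1) {i : ℕ} (hi : i < 2 * N) :
    1 / (((2 * N - 1 - i : ℕ) : ℚ) + 1)
      = -(1 / ((i : ℚ) + 1)) + p * (1 / ((i : ℚ) + 1) * (1 / (((2 * N - 1 - i : ℕ) : ℚ) + 1))) := by
  have h1 : (i : ℚ) + 1 ≠ 0 := by positivity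
  have h2 : ((2 * N - 1 - i : ℕ) : ℚ) + 1 ≠ 0 := by positivity
  have h3 : (p : ℚ) = (i + 1) + (((2 * N - 1 - i : ℕ) : ℚ) + 1) := by
    rw [hN]
    have : 2 * N + 1 = (i + 1) + ((2 * N - 1 - i) + 1) := by omega
    exact_mod_cast this
  rw [h3]
  field_simp
  ring

/-! ### Wolstenholme-type congruences from the reflection m ↦ p - m. -/

section Congruences

variable {p : ℕ} [hp : Fact p.Prime] {N : ℕ}

theorem inv_succ_mem {i : ℕ} (hi : i + 1 < p) : 1 / ((i : ℚ) + 1) ∈ pIntegral p := by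
  have := inv_natCast_mem (p := p) (m := i + 1) (Nat.not_dvd_of_pos_of_lt i.succ_pos hi)
  simpa using this

theorem inv_odd_mem {i : ℕ} (hi : 2 * i + 1 < p) : 1 / (2 * (i : ℚ) + 1) ∈ pIntegral p := by
  have := inv_succ_mem hi
  simpa using this

theorem harm_mem {n : ℕ} (hn : n < p) : harm n ∈ pIntegral p :=
  sum_mem fun i hi => inv_succ_mem (by have := mem_range.mp hi; omega)

theorem harmSq_mem {n : ℕ} (hn : n < p) : harmSq n ∈ pIntegral p :=
  sum_mem fun i hi => pow_mem (inv_succ_mem (by have := mem_range.mp hi; omega)) 2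

theorem oddHarm_mem {n : ℕ} (hn : 2 * n ≤ p) : oddHarm n ∈ pIntegral p :=
  sum_mem fun i hi => inv_odd_mem (by have := mem_range.mp hi; omega)

theorem inv_reflect_cong (hN : p = 2 * N + 1) {i : ℕ} (hi : i < 2 * N) :
    PCong p 1 (1 / (((2 * N - 1 - i : ℕ) : ℚ) + 1)) (-(1 / ((i : ℚ) + 1))) :=
  ⟨_, mul_mem (inv_succ_mem (i := i) (by omega)) (inv_succ_mem (i := 2 * N - 1 - i) (by omega)),
    by linear_combination inv_reflect hN hi⟩

theorem harmSq_two_mul_cong (hN : p = 2 * N + 1) :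
    PCong p 1 (harmSq (2 * N)) (2 * harmSq N) := by
  rw [harmSq, sum_range_two_mul_reflect, harmSq, mul_sum]
  refine PCong.sum fun i hi => ?_
  have hi' := mem_range.mp hi
  have h := inv_reflect_cong hN (i := i) (by omega)
  have h1 := inv_succ_mem (p := p) (i := i) (by omega)
  have h2 := inv_succ_mem (p := p) (i := 2 * N - 1 - i) (by omega)
  refine (h.mul h2 (neg_mem h1) h).congr ?_
  ring

/-- Reflection exchanges the odd numbers below p with the even ones. -/
theorem oddHarmSq_cong (hN : p = 2 * N + 1) : PCong p 1 (oddHarmSq N) (harmSq N / 4) := by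
  rw [oddHarmSq, ← sum_range_reflect, harmSq, sum_div]
  refine PCong.sum fun i hi => ?_
  have hi' := mem_range.mp hi
  have h := inv_reflect_cong hN (i := 2 * i + 1) (by omega)
  have h1 := inv_succ_mem (p := p) (i := 2 * i + 1) (by omega)
  have h2 := inv_succ_mem (p := p) (i := 2 * N - 1 - (2 * i + 1)) (by omega)
  refine (h.mul h2 (neg_mem h1) h).congr ?_
  have e : 2 * N - 1 - (2 * i + 1) = 2 * (N - 1 - i) := by omega
  have h4 : (i : ℚ) + 1 ≠ 0 := by positivity
  rw [e]
  push_cast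
  rw [show 2 * (i : ℚ) + 1 + 1 = 2 * (i + 1) by ring]
  field_simp
  ring

/-- The sum of 1/m² over all m < p is 2 H_N⁽²⁾ by reflection and H_N⁽²⁾/2 by parity. The difference
is 3/2 times H_N⁽²⁾, and 3/2 is a unit for p ≥ 5. -/
theorem harmSq_half_cong (hN : p = 2 * N + 1) (hp5 : 5 ≤ p) : PCong p 1 (harmSq N) 0 := by
  have h3 : 1 / (3 : ℚ) ∈ pIntegral p := by
    have := inv_succ_mem (p := p) (i := 2) (by omega)
    norm_num at this ⊢
    exact this
  have h := oddHarmSq_cong hN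
  have h' := harmSq_two_mul_cong hN
  rw [harmSq_two_mul] at h'
  refine ((h.sub h').mul_left (mul_mem (natCast_mem _ 2) h3)).congr ?_
  push_cast
  ring

theorem oddHarmSq_half_cong (hN : p = 2 * N + 1) (hp5 : 5 ≤ p) : PCong p 1 (oddHarmSq N) 0 := by
  refine (oddHarmSq_cong hN).trans ?_
  refine ((harmSq_half_cong hN hp5).mul_left (inv_two_pow_mem (by omega) 2)).congr ?_
  ring

/-- Pairing m with p - m gives 1/m + 1/(p - m) = p/(m(p - m)). The first factor p is explicit; the
second comes from H_N⁽²⁾ ≡ 0. -/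
theorem harm_pred_cong (hN : p = 2 * N + 1) (hp5 : 5 ≤ p) : PCong p 2 (harm (2 * N)) 0 := by
  have h : PCong p 1 (∑ i ∈ range N,
      1 / ((i : ℚ) + 1) * (1 / (((2 * N - 1 - i : ℕ) : ℚ) + 1))) (-harmSq N) := by
    rw [harmSq, ← sum_neg_distrib]
    refine PCong.sum fun i hi => ?_
    have hi' := mem_range.mp hi
    refine ((inv_reflect_cong hN (i := i) (by omega)).mul_left
      (inv_succ_mem (i := i) (by omega))).congr ?_
    ring
  have h2 := (h.trans (harmSq_half_cong hN hp5).neg).prime_mul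
  rw [harm, sum_range_two_mul_reflect]
  refine h2.congr ?_
  rw [mul_sum, neg_zero, mul_zero]
  congr 1
  refine sum_congr rfl fun i hi => ?_
  have hi' := mem_range.mp hi
  linear_combination inv_reflect hN (i := i) (by omega)

theorem harm_half_cong (hN : p = 2 * N + 1) (hp5 : 5 ≤ p) :
    PCong p 2 (harm N) (-2 * oddHarm N) := by
  have h := harm_pred_cong hN hp5
  rw [harm_two_mul] at h
  refine (h.mul_left (natCast_mem _ 2)).congr ?_
  push_cast
  ring

theorem harm_reflect_cong (hN : p = 2 * N + 1) (hp5 : 5 ≤ p) {j : ℕ} (hj : j ≤ 2 * N) :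
    PCong p 1 (harm (2 * N - j)) (harm j) := by
  induction j with
  | zero => simpa [harm] using (harm_pred_cong hN hp5).mono (m := 1) (by norm_num)
  | succ j ih =>
    have e : 2 * N - j = (2 * N - 1 - j) + 1 := by omega
    have h := ih (by omega)
    rw [e, harm_succ] at h
    rw [show 2 * N - (j + 1) = 2 * N - 1 - j by omega, harm_succ]
    refine (h.sub (inv_reflect_cong hN (i := j) (by omega))).congr ?_
    ring

end Congruences

/-! ### The Fermat quotient of two -/

/-- Both sides are (2n)!/n!. -/
theorem prod_range_add_eq (n : ℕ) :
    ∏ s ∈ range n, ((n : ℚ) + 1 + s) = 2 ^ n * ∏ s ∈ range n, (2 * (s : ℚ) + 1) := by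
  induction n with
  | zero => simp
  | succ n ih =>
    have h : ∏ s ∈ range (n + 2), ((n : ℚ) + 1 + s)
        = (∏ s ∈ range n, ((n : ℚ) + 1 + s)) * (2 * n + 1) * (2 * n + 2) := by
      rw [prod_range_succ, prod_range_succ]
      push_cast
      ring
    rw [prod_range_succ', ih] at h
    have e : ∀ s : ℕ, (n : ℚ) + 1 + ((s + 1 : ℕ) : ℚ) = ((n + 1 : ℕ) : ℚ) + 1 + s := by
      intro s; push_cast; ring
    simp only [e] at h
    have hn : (n : ℚ) + 1 ≠ 0 := by positivity
    rw [prod_range_succ (fun s : ℕ => 2 * (s : ℚ) + 1)]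
    apply mul_right_cancel₀ hn
    push_cast at h ⊢
    rw [add_zero] at h
    rw [h]
    ring

theorem prod_one_add_div_odd {p N : ℕ} (hN : p = 2 * N + 1) :
    ∏ s ∈ range N, (1 + (p : ℚ) * (1 / (2 * (s : ℚ) + 1))) = 2 ^ (2 * N) := by
  have h1 : ∀ s ∈ range N, 1 + (p : ℚ) * (1 / (2 * (s : ℚ) + 1))
      = 2 * ((N + 1 + s) / (2 * (s : ℚ) + 1)) := by
    intro s _
    have : 2 * (s : ℚ) + 1 ≠ 0 := by positivity
    rw [hN]
    push_cast
    field_simp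
    ring
  rw [prod_congr rfl h1, prod_mul_distrib, prod_div_distrib, prod_range_add_eq, prod_const,
    card_range]
  have : ∏ s ∈ range N, (2 * (s : ℚ) + 1) ≠ 0 :=
    prod_ne_zero_iff.mpr fun s _ => by positivity
  field_simp
  ring

/-- The Fermat quotient `(2 ^ (p - 1) - 1) / p`. -/
def fermatQ (p : ℕ) : ℚ := (2 ^ (p - 1) - 1) / p

section FermatQuotient

variable {p : ℕ} [hp : Fact p.Prime] {N : ℕ}

theorem two_pow_eq_fermatQ (hN : p = 2 * N + 1) : (2 : ℚ) ^ (2 * N) = 1 + p * fermatQ p := by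
  have hp0 : (p : ℚ) ≠ 0 := Nat.cast_ne_zero.mpr hp.out.ne_zero
  have : p - 1 = 2 * N := by omega
  rw [fermatQ, this]
  field_simp
  ring

/-- Second-order expansion of `prod_one_add_div_odd`, whose value is 1 + pq; the sum of squares
drops out since it is divisible by p. -/
theorem fermatQ_cong_oddHarm (hN : p = 2 * N + 1) (hp5 : 5 ≤ p) :
    PCong p 2 (fermatQ p) (oddHarm N + p * oddHarm N ^ 2 / 2) := by
  apply PCong.of_prime_mul
  have h := PCong.prod_one_add (p := p) (by omega) (range N) (fun s => 1 / (2 * (s : ℚ) + 1))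
    fun s hs => inv_odd_mem (by have := mem_range.mp hs; omega)
  rw [prod_one_add_div_odd hN, two_pow_eq_fermatQ hN] at h
  change PCong p 3 _ (1 + p * oddHarm N + p ^ 2 * (oddHarm N ^ 2 - oddHarmSq N) / 2) at h
  have h2 := ((oddHarmSq_half_cong hN hp5).prime_mul.prime_mul.mul_left
    (inv_two_pow_mem (p := p) (by omega) 1))
  refine (h.sub h2).congr ?_
  ring

theorem fermatQ_mem (hN : p = 2 * N + 1) (hp5 : 5 ≤ p) : fermatQ p ∈ pIntegral p := by
  have h := oddHarm_mem (p := p) (n := N) (by omega)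
  rw [(fermatQ_cong_oddHarm hN hp5).mem_iff]
  exact add_mem h (div_two_mem (by omega) (mul_mem (natCast_mem _ p) (pow_mem h 2)))

theorem oddHarm_half_cong (hN : p = 2 * N + 1) (hp5 : 5 ≤ p) :
    PCong p 2 (oddHarm N) (fermatQ p - p * fermatQ p ^ 2 / 2) := by
  have hO := oddHarm_mem (p := p) (n := N) (by omega)
  have hq := fermatQ_mem hN hp5
  have h := fermatQ_cong_oddHarm hN hp5
  obtain ⟨e, he, h⟩ := h
  -- Inverts q = O + pO²/2 + p²e: the error is p(q² - O²)/2 - p²e, and q - O = p(O²/2 + pe) supplies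
  -- the second factor p.
  refine ⟨(oddHarm N + fermatQ p) / 2 * (oddHarm N ^ 2 / 2 + p * e) - e, ?_, ?_⟩
  · exact sub_mem (mul_mem (div_two_mem (by omega) (add_mem hO hq))
      (add_mem (div_two_mem (by omega) (pow_mem hO 2)) (mul_mem (natCast_mem _ p) he))) he
  · linear_combination (p / 2 * (oddHarm N + fermatQ p) - 1) * h

theorem harm_half_cong_fermatQ (hN : p = 2 * N + 1) (hp5 : 5 ≤ p) :
    PCong p 2 (harm N) (-2 * fermatQ p + p * fermatQ p ^ 2) := by
  refine (harm_half_cong hN hp5).trans ?_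
  refine ((oddHarm_half_cong hN hp5).mul_left (neg_mem (natCast_mem _ 2))).congr ?_
  push_cast
  ring

end FermatQuotient

/-! ### The harmonic number at ⌊p/4⌋. -/

/-- For r < k ≤ N the factor is 1 - p/(2k) = -(p - 2k)/(2k), and p - 2k runs over the first N - r
odd numbers. The product is thus ± 2^(-N); squaring removes the sign. -/
theorem prod_range_quarter {p N r : ℕ} (hN : p = 2 * N + 1) (hr : N = 2 * r ∨ N = 2 * r + 1) :
    (∏ i ∈ range (N - r), (1 + (p : ℚ) * (-(1 / (((r + i : ℕ) : ℚ) + 1)) / 2))) ^ 2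
      * 2 ^ (2 * N) = 1 := by
  obtain ⟨m, hm⟩ : ∃ m, N = r + m := ⟨N - r, by omega⟩
  have hD : ∏ i ∈ range m, ((r : ℚ) + 1 + i) = 2 ^ r * ∏ s ∈ range m, (2 * (s : ℚ) + 1) := by
    rcases (show m = r ∨ m = r + 1 by omega) with rfl | rfl
    · exact prod_range_add_eq m
    · rw [prod_range_succ, prod_range_add_eq, prod_range_succ]
      ring
  have hD0 : ∏ s ∈ range m, (2 * (s : ℚ) + 1) ≠ 0 :=
    prod_ne_zero_iff.mpr fun s _ => by positivity
  have e : ∀ i ∈ range m, 1 + (p : ℚ) * (-(1 / (((r + i : ℕ) : ℚ) + 1)) / 2)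
      = -2⁻¹ * ((2 * ((m - 1 - i : ℕ) : ℚ) + 1) / ((r : ℚ) + 1 + i)) := by
    intro i hi
    have hi' := mem_range.mp hi
    have h1 : (p : ℚ) = 2 * (r + 1 + i) + (2 * ((m - 1 - i : ℕ) : ℚ) + 1) := by
      have : p = 2 * (r + 1 + i) + (2 * (m - 1 - i) + 1) := by omega
      exact_mod_cast this
    have h2 : (r : ℚ) + 1 + i ≠ 0 := by positivity
    rw [h1]
    push_cast
    rw [show (r : ℚ) + i + 1 = r + 1 + i by ring]
    field_simp
    ring
  rw [show N - r = m by omega, prod_congr rfl e, prod_mul_distrib, prod_div_distrib,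
    prod_range_reflect (fun i : ℕ => 2 * (i : ℚ) + 1), hD, prod_const, card_range, hm]
  have h3 : ((-2⁻¹ : ℚ) ^ m) ^ 2 * 2 ^ (2 * m) = 1 := by
    rw [← pow_mul, mul_comm m 2, ← mul_pow, pow_mul]
    norm_num
  rw [show (2 : ℚ) ^ (2 * (r + m)) = (2 ^ r) ^ 2 * 2 ^ (2 * m) by ring, mul_pow]
  rw [show ∀ a b c d : ℚ, a * b * (c * d) = a * d * (b * c) by intros; ring, h3]
  field_simp

section Quarter

variable {p : ℕ} [hp : Fact p.Prime] {N r : ℕ}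

theorem harm_quarter_cong (hN : p = 2 * N + 1) (hp5 : 5 ≤ p) (hr : N = 2 * r ∨ N = 2 * r + 1) :
    PCong p 2 (harm r)
      (-3 * fermatQ p + 3 / 2 * p * fermatQ p ^ 2 - p * harmSq r / 4) := by
  have hp2 : p ≠ 2 := by omega
  have hq := fermatQ_mem hN hp5
  have hh : harm N - harm r ∈ pIntegral p := sub_mem (harm_mem (by omega)) (harm_mem (by omega))
  have hh2 : harmSq N - harmSq r ∈ pIntegral p :=
    sub_mem (harmSq_mem (by omega)) (harmSq_mem (by omega))
  have hp1 : (p : ℚ) ∈ pIntegral p := natCast_mem _ p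
  set g : ℕ → ℚ := fun i => 1 / (((r + i : ℕ) : ℚ) + 1) with hg
  have hgm : ∀ i ∈ range (N - r), g i ∈ pIntegral p := fun i hi =>
    inv_succ_mem (by have := mem_range.mp hi; omega)
  have s1 : ∑ i ∈ range (N - r), g i = harm N - harm r := by
    rw [harm, harm, eq_sub_iff_add_eq', ← sum_range_add, Nat.add_sub_cancel' (by omega)]
  have s2 : ∑ i ∈ range (N - r), g i ^ 2 = harmSq N - harmSq r := by
    rw [harmSq, harmSq, eq_sub_iff_add_eq',
      ← sum_range_add (fun x : ℕ => (1 / ((x : ℚ) + 1)) ^ 2), Nat.add_sub_cancel' (by omega)]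
  have hM := PCong.prod_one_add (p := p) hp2 (range (N - r)) (fun i => -g i / 2)
    fun i hi => div_two_mem hp2 (neg_mem (hgm i hi))
  have hM1 := prod_range_quarter hN hr
  rw [two_pow_eq_fermatQ hN] at hM1
  have s3 : ∑ i ∈ range (N - r), -g i / 2 = -(harm N - harm r) / 2 := by
    rw [← s1, ← sum_div, sum_neg_distrib]
  have s4 : ∑ i ∈ range (N - r), (-g i / 2) ^ 2 = (harmSq N - harmSq r) / 4 := by
    rw [← s2, sum_div]
    exact sum_congr rfl fun i _ => by ring
  rw [s3, s4] at hM
  set M := ∏ i ∈ range (N - r), (1 + (p : ℚ) * (-g i / 2))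
  have hMm : M ∈ pIntegral p := prod_mem fun i hi =>
    add_mem (one_mem _) (mul_mem hp1 (div_two_mem hp2 (neg_mem (hgm i hi))))
  set h := harm N - harm r with hdef
  set k := harmSq N - harmSq r with kdef
  set q := fermatQ p
  have ha : (h ^ 2 - k) / 8 ∈ pIntegral p := div_eight_mem hp2 (sub_mem (pow_mem hh 2) hh2)
  have hY : 1 + p * (-h / 2) + p ^ 2 * ((-h / 2) ^ 2 - k / 4) / 2 ∈ pIntegral p :=
    hM.mem_iff.mp hMm
  have hMY := (PCong.mul hMm hY hM hM).mul_left
    (c := 1 + p * q) (add_mem (one_mem _) (mul_mem hp1 hq))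
  have c2 : PCong p 2 (q - h + p * (h ^ 2 / 2 - k / 4 - q * h)) 0 := by
    apply PCong.of_prime_mul
    -- The p³ term is the exact remainder of (1 + pq)Y², where Y = 1 - ph/2 + p²(h² - k)/8.
    refine PCong.trans ?_ (hMY.symm.congr (z := p * (q - h + p * (h ^ 2 / 2 - k / 4 - q * h)) +
      p ^ 3 * (-h * ((h ^ 2 - k) / 8) + p * ((h ^ 2 - k) / 8) ^ 2
        + q * (h ^ 2 / 4 + 2 * ((h ^ 2 - k) / 8) - p * (h * ((h ^ 2 - k) / 8))
          + p ^ 2 * ((h ^ 2 - k) / 8) ^ 2))) (w := p * 0) ?_)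
    · refine PCong.symm ⟨_, ?_, add_sub_cancel_left _ _⟩
      exact add_mem (add_mem (mul_mem (neg_mem hh) ha) (mul_mem hp1 (pow_mem ha 2)))
        (mul_mem hq (add_mem (sub_mem (add_mem (div_four_mem hp2 (pow_mem hh 2))
          (mul_mem (natCast_mem _ 2) ha)) (mul_mem hp1 (mul_mem hh ha)))
          (mul_mem (pow_mem hp1 2) (pow_mem ha 2))))
    · linear_combination hM1
  have c1 : PCong p 1 (q - h) 0 := by
    refine PCong.trans ?_ (c2.mono (m := 1) (by norm_num))
    refine PCong.symm ⟨h ^ 2 / 2 - k / 4 - q * h, ?_, by ring⟩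
    exact sub_mem (sub_mem (div_two_mem hp2 (pow_mem hh 2)) (div_four_mem hp2 hh2))
      (mul_mem hq hh)
  -- Since h ≡ q mod p, the square (q - h)² is negligible here; subtracting half of it turns h²/2 -
  -- qh into -q²/2.
  have c3 : PCong p 2 (p * ((q - h) / 2 * (q - h))) (p * ((q - h) / 2 * 0)) :=
    (c1.mul_left (div_two_mem hp2 (sub_mem hq hh))).prime_mul
  have c4 : PCong p 2 (p * (1 / 2 ^ 2 * harmSq N)) (p * (1 / 2 ^ 2 * 0)) :=
    ((harmSq_half_cong hN hp5).mul_left (inv_two_pow_mem hp2 2)).prime_mul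
  refine ((((harm_half_cong_fermatQ hN hp5).add c2).sub c3).add c4).congr ?_
  rw [hdef, kdef]
  ring

end Quarter

/-! ### Alternating double sums -/

/-- An alternating harmonic double sum. -/
def altHarm (n : ℕ) : ℚ :=
  ∑ i ∈ range n, (-1 : ℚ) ^ i * ((harm i + harm (i + 1)) * (1 / ((i : ℚ) + 1)))

theorem choose_succ_eq (n i : ℕ) (hi : i < n) :
    (n.choose (i + 1) : ℚ) = n * ((-1) ^ i * (1 / ((i : ℚ) + 1))
      * ∏ s ∈ range i, (1 + (n : ℚ) * -(1 / ((s : ℚ) + 1)))) := by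
  induction i with
  | zero => simp
  | succ i ih =>
    have h := Nat.choose_succ_right_eq n (i + 1)
    have h' : (n.choose (i + 2) : ℚ) * (i + 2) = n.choose (i + 1) * (n - (i + 1)) := by
      have : ((n - (i + 1) : ℕ) : ℚ) = n - (i + 1) := by
        rw [Nat.cast_sub (by omega)]; push_cast; ring
      rw [← this]
      exact_mod_cast h
    rw [ih (by omega)] at h'
    have h1 : (i : ℚ) + 1 ≠ 0 := by positivity
    have h2 : (i : ℚ) + 2 ≠ 0 := by positivity
    rw [prod_range_succ]
    apply mul_right_cancel₀ h2
    rw [show i + 1 + 1 = i + 2 by ring, h']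
    push_cast
    rw [show (i : ℚ) + 1 + 1 = i + 2 by ring]
    field_simp
    ring

section Alternating

variable {p : ℕ} [hp : Fact p.Prime] {N r : ℕ}

/-- The binomial coefficients C(p, m) with 0 < m < p add up to 2^p - 2 = 2pq. -/
theorem two_mul_fermatQ (hN : p = 2 * N + 1) :
    2 * fermatQ p = ∑ i ∈ range (2 * N), (-1) ^ i * (1 / ((i : ℚ) + 1))
      * ∏ s ∈ range i, (1 + (p : ℚ) * -(1 / ((s : ℚ) + 1))) := by
  have hp0 : (p : ℚ) ≠ 0 := Nat.cast_ne_zero.mpr hp.out.ne_zero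
  apply mul_left_cancel₀ hp0
  rw [mul_sum, ← sum_congr rfl fun i hi =>
    choose_succ_eq p i (by have := mem_range.mp hi; omega)]
  have h : ∑ m ∈ range (p + 1), (p.choose m : ℚ) = 2 ^ p := by
    exact_mod_cast Nat.sum_range_choose p
  rw [sum_range_succ, Nat.choose_self, hN, sum_range_succ', Nat.choose_zero_right, ← hN] at h
  have h2 := two_pow_eq_fermatQ hN
  have h3 : (2 : ℚ) ^ p = 2 * 2 ^ (2 * N) := by rw [← pow_succ', ← hN]
  rw [h3, h2] at h
  push_cast at h
  linear_combination -h

/-- To first order in p, `two_mul_fermatQ` reads 2q ≡ H_{p-1} - H_N - p·(this sum) mod p², and the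
two harmonic numbers are already known mod p². -/
theorem sum_alternating_harm_cong (hN : p = 2 * N + 1) (hp5 : 5 ≤ p) :
    PCong p 1 (∑ i ∈ range (2 * N), (-1 : ℚ) ^ i * (1 / ((i : ℚ) + 1) * harm i))
      (-fermatQ p ^ 2) := by
  apply PCong.of_prime_mul
  have h : PCong p 2 (2 * fermatQ p) (∑ i ∈ range (2 * N),
      ((-1 : ℚ) ^ i * (1 / ((i : ℚ) + 1)) * (1 + p * ∑ s ∈ range i, -(1 / ((s : ℚ) + 1))))) := by
    rw [two_mul_fermatQ hN]
    refine PCong.sum fun i hi => ?_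
    have hi' := mem_range.mp hi
    refine (PCong.prod_one_add' (range i) _ fun s hs => neg_mem (inv_succ_mem ?_)).mul_left
      (mul_mem (pow_mem (neg_mem (one_mem _)) i) (inv_succ_mem (by omega)))
    have := mem_range.mp hs
    omega
  have e : ∑ i ∈ range (2 * N),
      ((-1 : ℚ) ^ i * (1 / ((i : ℚ) + 1)) * (1 + p * ∑ s ∈ range i, -(1 / ((s : ℚ) + 1))))
      = harm (2 * N) - harm N
        - p * ∑ i ∈ range (2 * N), (-1 : ℚ) ^ i * (1 / ((i : ℚ) + 1) * harm i) := by
    have e2 : harm (2 * N) - harm N = oddHarm N - harm N / 2 := by rw [harm_two_mul]; ring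
    rw [e2, ← sum_alternating_inv, mul_sum, ← sum_sub_distrib]
    refine sum_congr rfl fun i _ => ?_
    rw [sum_neg_distrib, harm]
    ring
  rw [e] at h
  refine ((h.sub (harm_half_cong_fermatQ hN hp5)).add (harm_pred_cong hN hp5)).congr ?_
  ring

/-- Folds the sum over i < 2N at its middle: under i ↦ 2N - 1 - i the signs of (-1)^i and of 1/(i +
1) both flip, while H_i becomes H_{i+1} mod p. -/
theorem altHarm_cong (hN : p = 2 * N + 1) (hp5 : 5 ≤ p) :
    PCong p 1 (altHarm N) (-fermatQ p ^ 2) := by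
  refine PCong.trans ?_ (sum_alternating_harm_cong hN hp5)
  rw [sum_range_two_mul_reflect, altHarm]
  refine PCong.sum fun i hi => PCong.symm ?_
  have hi' := mem_range.mp hi
  have h1 := inv_reflect_cong hN (i := i) (by omega)
  have h2 := harm_reflect_cong hN hp5 (j := i + 1) (by omega)
  rw [show 2 * N - (i + 1) = 2 * N - 1 - i by omega] at h2
  have h3 := (h1.mul (inv_succ_mem (by omega)) (harm_mem (by omega)) h2).mul_left
    (c := (-1) ^ (2 * N - 1 - i)) (pow_mem (neg_mem (one_mem _)) _)
  have e : (-1 : ℚ) ^ (2 * N - 1 - i) = -(-1) ^ i := by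
    have : 2 * N - 1 - i + i + 1 = 2 * N := by omega
    have h4 : (-1 : ℚ) ^ (2 * N - 1 - i) * (-1) ^ i * (-1) = 1 := by
      rw [← pow_add, ← pow_succ, this, pow_mul]; norm_num
    have h5 : (-1 : ℚ) ^ i * (-1) ^ i = 1 := by
      rw [← pow_add, ← two_mul, pow_mul]; norm_num
    linear_combination (-(-1 : ℚ) ^ i) * h4 - (-1 : ℚ) ^ (2 * N - 1 - i) * h5
  rw [e] at h3 ⊢
  refine h3.congr ?_
  ring

end Alternating

/-! ### The sum of O_j / j modulo p. -/

/-- The sum of `O_j / j`, where `O_j` is the sum of reciprocals of the first `j` odd numbers. -/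
def oddHarmSum (r : ℕ) : ℚ := ∑ j ∈ range r, 1 / ((j : ℚ) + 1) * oddHarm (j + 1)

/-- As H_m² - H_{m-1}² = (H_m + H_{m-1})/m, half of H_{2r}² - `altHarm (2 * r)` keeps exactly the
even m, while H_r² telescopes in the same way. Termwise the rest is O_j = H_{2j} - H_j/2. -/
theorem oddHarmSum_eq_even (r : ℕ) :
    oddHarmSum r = (harm (2 * r) ^ 2 - altHarm (2 * r)) / 2 - harm r ^ 2 / 4 := by
  induction r with
  | zero => simp [oddHarmSum, harm, altHarm]
  | succ r ih =>
    have h1 := harm_two_mul (r + 1)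
    have h2 : oddHarmSum (r + 1) = oddHarmSum r + 1 / ((r : ℚ) + 1) * oddHarm (r + 1) :=
      sum_range_succ _ _
    have h3 : altHarm (2 * (r + 1)) = altHarm (2 * r)
        + (harm (2 * r) + harm (2 * r + 1)) * (1 / (2 * (r : ℚ) + 1))
        - (harm (2 * r + 1) + harm (2 * r + 2)) * (1 / (2 * (r : ℚ) + 2)) := by
      rw [altHarm, show 2 * (r + 1) = 2 * r + 1 + 1 by ring, sum_range_succ, sum_range_succ,
        ← altHarm, pow_succ, pow_mul]
      push_cast
      ring
    have h4 : harm (2 * r + 1) = harm (2 * r) + 1 / (2 * (r : ℚ) + 1) := by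
      rw [harm_succ]; push_cast; ring
    have h5 : harm (2 * r + 2) = harm (2 * r) + 1 / (2 * (r : ℚ) + 1) + 1 / (2 * (r : ℚ) + 2) := by
      rw [show 2 * r + 2 = 2 * r + 1 + 1 by ring, harm_succ, h4]
      push_cast
      ring
    have h6 := harm_succ r
    rw [show 2 * (r + 1) = 2 * r + 2 by ring, h5] at h1
    have h7 : oddHarm (r + 1) = harm (2 * r) + 1 / (2 * (r : ℚ) + 1) + 1 / (2 * (r : ℚ) + 2)
        - (harm r + 1 / ((r : ℚ) + 1)) / 2 := by
      rw [h1, h6]; ring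
    rw [h2, ih, h3, show 2 * (r + 1) = 2 * r + 2 by ring, h4, h5, h6, h7,
      show 2 * (r : ℚ) + 2 = 2 * (r + 1) by ring]
    have : (r : ℚ) + 1 ≠ 0 := by positivity
    have : 2 * (r : ℚ) + 1 ≠ 0 := by positivity
    field_simp
    ring

/-- For odd N the extra term has positive sign, so H_N² and `altHarm N` grow by the same amount. -/
theorem oddHarmSum_eq {N r : ℕ} (hr : N = 2 * r ∨ N = 2 * r + 1) :
    oddHarmSum r = (harm N ^ 2 - altHarm N) / 2 - harm r ^ 2 / 4 := by
  rcases hr with rfl | rfl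
  · exact oddHarmSum_eq_even r
  · rw [oddHarmSum_eq_even, harm_succ (2 * r), altHarm, altHarm, sum_range_succ _ (2 * r),
      pow_mul, harm_succ (2 * r)]
    push_cast
    ring

theorem oddHarmSum_cong {p : ℕ} [hp : Fact p.Prime] {N r : ℕ} (hN : p = 2 * N + 1)
    (hp5 : 5 ≤ p) (hr : N = 2 * r ∨ N = 2 * r + 1) :
    PCong p 1 (oddHarmSum r) (fermatQ p ^ 2 / 4) := by
  have hp2 : p ≠ 2 := by omega
  have hq := fermatQ_mem hN hp5
  have h1 : PCong p 1 (harm N) (-2 * fermatQ p) := by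
    refine ((harm_half_cong_fermatQ hN hp5).mono (m := 1) (by norm_num)).trans ?_
    exact ⟨_, pow_mem hq 2, by ring⟩
  have h2 : PCong p 1 (harm r) (-3 * fermatQ p) := by
    refine ((harm_quarter_cong hN hp5 hr).mono (m := 1) (by norm_num)).trans ?_
    refine ⟨3 * (fermatQ p ^ 2 / 2) - harmSq r / 4, ?_, by ring⟩
    exact sub_mem (mul_mem (natCast_mem _ 3) (div_two_mem hp2 (pow_mem hq 2)))
      (div_four_mem hp2 (harmSq_mem (by omega)))
  have m1 := h1.mul (harm_mem (by omega)) (h1.mem_iff.mp (harm_mem (by omega))) h1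
  have m2 := h2.mul (harm_mem (by omega)) (h2.mem_iff.mp (harm_mem (by omega))) h2
  rw [oddHarmSum_eq hr]
  refine (((m1.sub (altHarm_cong hN hp5)).mul_left (inv_two_pow_mem hp2 1)).sub
    (m2.mul_left (inv_two_pow_mem hp2 2))).congr ?_
  ring

/-! ### The truncated hypergeometric sum -/

/-- The polynomial `binom(x, k) * binom(-1 - x, k)` in `x`. -/
def chooseProd (k : ℕ) (x : ℚ) : ℚ :=
  ∏ i ∈ range k, ((i : ℚ) - x) * (i + 1 + x) / ((i : ℚ) + 1) ^ 2

/-- The polynomial `2 * (-1) ^ n * binom(x, n) * binom(x + n + 1, n)` in `x`. -/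
def shiftTerm (n : ℕ) (x : ℚ) : ℚ :=
  2 * ∏ i ∈ range n, ((i : ℚ) - x) * (x + 2 + i) / ((i : ℚ) + 1) ^ 2

/-- The truncated sum `(2 x + 1) * ∑ binom(x, k) * binom(-1 - x, k) / (2 k + 1)`. -/
def truncSum (n : ℕ) (x : ℚ) : ℚ :=
  (2 * x + 1) * ∑ k ∈ range (n + 1), chooseProd k x * (1 / (2 * (k : ℚ) + 1))

theorem chooseProd_succ (k : ℕ) (x : ℚ) :
    chooseProd (k + 1) x = chooseProd k x * (((k : ℚ) - x) * (k + 1 + x) / ((k : ℚ) + 1) ^ 2) :=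
  prod_range_succ _ _

theorem shiftTerm_succ (n : ℕ) (x : ℚ) :
    shiftTerm (n + 1) x
      = shiftTerm n x * (((n : ℚ) - x) * (x + 2 + n) / ((n : ℚ) + 1) ^ 2) := by
  rw [shiftTerm, prod_range_succ, shiftTerm, mul_assoc]

theorem truncSum_succ (n : ℕ) (x : ℚ) :
    truncSum (n + 1) x
      = truncSum n x + (2 * x + 1) * (chooseProd (n + 1) x * (1 / (2 * (n : ℚ) + 3))) := by
  rw [truncSum, sum_range_succ, truncSum, mul_add]
  push_cast
  ring

theorem chooseProd_succ_eq (n : ℕ) (x : ℚ) :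
    2 * chooseProd (n + 1) x = shiftTerm n x * (((n : ℚ) - x) * (x + 1) / ((n : ℚ) + 1) ^ 2) := by
  induction n with
  | zero => rw [chooseProd, shiftTerm, prod_range_one, prod_range_zero]; push_cast; ring
  | succ n ih =>
    rw [chooseProd_succ, ← mul_assoc, ih, shiftTerm_succ]
    push_cast
    ring

theorem chooseProd_succ_add_one_eq (n : ℕ) (x : ℚ) :
    2 * chooseProd (n + 1) (x + 1)
      = shiftTerm n x * ((-x - 1) * (x + 2 + n) / ((n : ℚ) + 1) ^ 2) := by
  induction n with
  | zero => rw [chooseProd, shiftTerm, prod_range_one, prod_range_zero]; push_cast; ring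
  | succ n ih =>
    rw [chooseProd_succ, ← mul_assoc, ih, shiftTerm_succ]
    push_cast
    ring

/-- The induction on n closes because the new summands at x and x + 1 and the next `shiftTerm` are
all explicit rational multiples of `shiftTerm n x`. -/
theorem truncSum_add_one (n : ℕ) (x : ℚ) :
    truncSum n (x + 1) = truncSum n x + shiftTerm n x := by
  induction n with
  | zero => simp [truncSum, shiftTerm, chooseProd]; ring
  | succ n ih =>
    have h1 := chooseProd_succ_eq n x
    have h2 := chooseProd_succ_add_one_eq n x
    have h3 : 2 * (n : ℚ) + 3 ≠ 0 := by positivity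
    have h4 : (n : ℚ) + 1 ≠ 0 := by positivity
    have e1 : chooseProd (n + 1) x
        = shiftTerm n x * (((n : ℚ) - x) * (x + 1) / ((n : ℚ) + 1) ^ 2) / 2 := by
      rw [← h1]; ring
    have e2 : chooseProd (n + 1) (x + 1)
        = shiftTerm n x * ((-x - 1) * (x + 2 + n) / ((n : ℚ) + 1) ^ 2) / 2 := by
      rw [← h2]; ring
    rw [truncSum_succ, truncSum_succ, ih, shiftTerm_succ, e1, e2]
    field_simp
    ring

theorem truncSum_add_nat (n r : ℕ) (x : ℚ) :
    truncSum n (x + r) = truncSum n x + ∑ j ∈ range r, shiftTerm n (x + j) := by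
  induction r with
  | zero => simp
  | succ r ih =>
    rw [sum_range_succ, ← add_assoc, ← ih, ← truncSum_add_one]
    push_cast
    ring_nf

theorem shiftTerm_add_one (n : ℕ) (x : ℚ) :
    (n - x - 1) * (x + 2) * shiftTerm n (x + 1) = (-x - 1) * (x + n + 2) * shiftTerm n x := by
  induction n with
  | zero => simp only [shiftTerm, prod_range_zero]; push_cast; ring
  | succ n ih =>
    rw [shiftTerm_succ, shiftTerm_succ]
    push_cast
    linear_combination ((n : ℚ) - x) * (x + 3 + n) / ((n : ℚ) + 1) ^ 2 * ih

theorem shiftTerm_neg_one_sub (n : ℕ) (u : ℚ) :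
    shiftTerm n (-1 - u) = 2 * ∏ i ∈ range n, (1 - u ^ 2 * (1 / ((i : ℚ) + 1)) ^ 2) := by
  rw [shiftTerm]
  congr 1
  refine prod_congr rfl fun i _ => ?_
  have : (i : ℚ) + 1 ≠ 0 := by positivity
  field_simp
  ring

/-- Starts at x = -1 - u, where the product is even in u, and iterates `shiftTerm_add_one`. The
choice P = 2N + 1 makes each ratio 1 + P/(...), so for P = p the expansion in p is immediate. -/
theorem shiftTerm_eq {N : ℕ} {P u : ℚ} (hP : P = 2 * N + 1) (j : ℕ)
    (h1 : ∀ s < j, (N : ℚ) + 1 + s - u - P ≠ 0) (h2 : ∀ s < j, (s : ℚ) + 1 - u ≠ 0) :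
    (j - u) * shiftTerm N (-u + j - 1)
      = -2 * u * (∏ i ∈ range N, (1 - u ^ 2 * (1 / ((i : ℚ) + 1)) ^ 2))
        * ∏ s ∈ range j, (1 + P * (1 / ((N : ℚ) + 1 + s - u - P))) := by
  induction j with
  | zero =>
    have := shiftTerm_neg_one_sub N u
    rw [show (-u + ((0 : ℕ) : ℚ) - 1) = -1 - u by push_cast; ring, this]
    simp
    ring
  | succ j ih =>
    have h := ih (fun s hs => h1 s (by omega)) fun s hs => h2 s (by omega)
    have h3 := h1 j (by omega)
    have h4 := h2 j (by omega)
    rw [prod_range_succ, ← mul_assoc, ← h]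
    have h5 := shiftTerm_add_one N (-u + j - 1)
    rw [show -u + (j : ℚ) - 1 + 1 = -u + ((j + 1 : ℕ) : ℚ) - 1 by push_cast; ring] at h5
    apply mul_right_cancel₀ h3
    have h6 : (1 + P * (1 / ((N : ℚ) + 1 + j - u - P))) * ((N : ℚ) + 1 + j - u - P)
        = N + 1 + j - u := by
      field_simp
      ring
    rw [mul_assoc _ (1 + P * (1 / ((N : ℚ) + 1 + j - u - P))), h6, hP]
    push_cast at h5 ⊢
    linear_combination -h5

/-- Regroups the shifted factors into pairs (i + u)(i - u), leaving u and k + 1 - u unpaired. With u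
= p/4 the leading u is the source of a factor p. -/
theorem chooseProd_succ_neg (k : ℕ) (u : ℚ) :
    chooseProd (k + 1) (-u) = u * (1 / ((k : ℚ) + 1)) * (1 - u * (1 / ((k : ℚ) + 1)))
      * ∏ i ∈ range k, (1 - u ^ 2 * (1 / ((i : ℚ) + 1)) ^ 2) := by
  induction k with
  | zero => rw [chooseProd, prod_range_one, prod_range_zero]; push_cast; ring
  | succ k ih =>
    have h1 : (k : ℚ) + 1 ≠ 0 := by positivity
    have h2 : (k : ℚ) + 1 + 1 ≠ 0 := by positivity
    rw [chooseProd_succ, ih, prod_range_succ]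
    push_cast
    field_simp
    ring

theorem chooseProd_neg_quarter (k : ℕ) :
    chooseProd k (-1 / 4) = ((4 * k).choose (2 * k) : ℚ) * ((2 * k).choose k : ℚ) / 64 ^ k := by
  have e : ∀ k : ℕ, ((4 * k).choose (2 * k) : ℚ) * ((2 * k).choose k : ℚ)
      = (2 * k).centralBinom * k.centralBinom := by
    intro k
    rw [Nat.centralBinom_eq_two_mul_choose, Nat.centralBinom_eq_two_mul_choose,
      show 2 * (2 * k) = 4 * k by ring]
  rw [e]
  induction k with
  | zero => simp [chooseProd]
  | succ k ih =>
    have h1 : ((k : ℚ) + 1) * (k + 1).centralBinom = 2 * (2 * k + 1) * k.centralBinom := by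
      exact_mod_cast Nat.succ_mul_centralBinom_succ k
    have h2 : (2 * (k : ℚ) + 1) * (2 * k + 1).centralBinom
        = 2 * (2 * (2 * k) + 1) * (2 * k).centralBinom := by
      exact_mod_cast Nat.succ_mul_centralBinom_succ (2 * k)
    have h3 : (2 * (k : ℚ) + 1 + 1) * (2 * (k + 1)).centralBinom
        = 2 * (2 * (2 * k + 1) + 1) * (2 * k + 1).centralBinom := by
      exact_mod_cast Nat.succ_mul_centralBinom_succ (2 * k + 1)
    have n1 : (k : ℚ) + 1 ≠ 0 := by positivity
    have n2 : 2 * (k : ℚ) + 1 ≠ 0 := by positivity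
    have n3 : 2 * (k : ℚ) + 1 + 1 ≠ 0 := by positivity
    rw [chooseProd_succ, ih]
    rw [eq_div_of_mul_eq n1 ((mul_comm _ _).trans h1),
      eq_div_of_mul_eq n3 ((mul_comm _ _).trans h3), eq_div_of_mul_eq n2 ((mul_comm _ _).trans h2)]
    rw [show 2 * (k : ℚ) + 1 + 1 = 2 * (k + 1) by ring]
    field_simp
    ring

theorem chooseProd_neg_three_quarters (k : ℕ) :
    chooseProd k (-3 / 4) = chooseProd k (-1 / 4) :=
  prod_congr rfl fun i _ => by ring

theorem sum_inv_mul_odd (n : ℕ) :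
    ∑ k ∈ range n, 1 / ((k : ℚ) + 1) * (1 / (2 * (k : ℚ) + 3))
      = harm n - 2 * oddHarm (n + 1) + 2 := by
  induction n with
  | zero => simp [harm, oddHarm]
  | succ n ih =>
    rw [sum_range_succ, ih, harm_succ, oddHarm_succ (n + 1)]
    have h1 : (n : ℚ) + 1 ≠ 0 := by positivity
    have h2 : 2 * (n : ℚ) + 3 ≠ 0 := by positivity
    push_cast
    rw [show 2 * ((n : ℚ) + 1) + 1 = 2 * n + 3 by ring]
    field_simp
    ring

theorem sum_inv_sq_mul_odd (n : ℕ) :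
    ∑ k ∈ range n, (1 / ((k : ℚ) + 1)) ^ 2 * (1 / (2 * (k : ℚ) + 3))
      = harmSq n - 2 * (harm n - 2 * oddHarm (n + 1) + 2) := by
  rw [← sum_inv_mul_odd, harmSq, mul_sum, ← sum_sub_distrib]
  refine sum_congr rfl fun k _ => ?_
  have h1 : (k : ℚ) + 1 ≠ 0 := by positivity
  have h2 : 2 * (k : ℚ) + 3 ≠ 0 := by positivity
  field_simp
  ring

/-! ### Expansions in powers of p and assembly. -/

section Final

variable {p : ℕ} [hp : Fact p.Prime] {N r : ℕ}

theorem prod_one_sub_sq_cong (hp2 : p ≠ 2) {n : ℕ} (hn : n < p) :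
    PCong p 3 (∏ i ∈ range n, (1 - ((p : ℚ) / 4) ^ 2 * (1 / ((i : ℚ) + 1)) ^ 2))
      (1 - p ^ 2 * (harmSq n / 16)) := by
  have hm : ∀ i ∈ range n, -(1 / ((i : ℚ) + 1)) ^ 2 / 16 ∈ pIntegral p := fun i hi =>
    div_sixteen_mem hp2 (neg_mem (pow_mem
      (inv_succ_mem (by have := mem_range.mp hi; omega)) 2))
  have hs : ∑ i ∈ range n, -(1 / ((i : ℚ) + 1)) ^ 2 / 16 = -harmSq n / 16 := by
    rw [harmSq, ← sum_neg_distrib, sum_div]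
  have h := PCong.prod_one_add hp2 (range n) (fun i => p * (-(1 / ((i : ℚ) + 1)) ^ 2 / 16))
    fun i hi => mul_mem (natCast_mem _ p) (hm i hi)
  have e : ∏ i ∈ range n, (1 - ((p : ℚ) / 4) ^ 2 * (1 / ((i : ℚ) + 1)) ^ 2)
      = ∏ i ∈ range n, (1 + (p : ℚ) * (p * (-(1 / ((i : ℚ) + 1)) ^ 2 / 16))) :=
    prod_congr rfl fun i _ => by ring
  rw [e]
  refine h.trans ?_
  have e2 : ∑ i ∈ range n, ((p : ℚ) * (-(1 / ((i : ℚ) + 1)) ^ 2 / 16)) ^ 2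
      = (p : ℚ) ^ 2 * ∑ i ∈ range n, (-(1 / ((i : ℚ) + 1)) ^ 2 / 16) ^ 2 := by
    rw [mul_sum]
    exact sum_congr rfl fun i _ => by ring
  rw [← mul_sum, hs, e2]
  refine ⟨p * (((-harmSq n / 16) ^ 2 - ∑ i ∈ range n, (-(1 / ((i : ℚ) + 1)) ^ 2 / 16) ^ 2) / 2),
    ?_, by ring⟩
  exact mul_mem (natCast_mem _ p) (div_two_mem hp2 (sub_mem
    (pow_mem (div_sixteen_mem hp2 (neg_mem (harmSq_mem hn))) 2)
    (sum_mem fun i hi => pow_mem (hm i hi) 2)))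

theorem prod_one_sub_sq_cong_one (hp2 : p ≠ 2) {n : ℕ} (hn : n < p) :
    PCong p 2 (∏ i ∈ range n, (1 - ((p : ℚ) / 4) ^ 2 * (1 / ((i : ℚ) + 1)) ^ 2)) 1 := by
  refine ((prod_one_sub_sq_cong hp2 hn).mono (m := 2) (by norm_num)).trans ?_
  exact ⟨-(harmSq n / 16), neg_mem (div_sixteen_mem hp2 (harmSq_mem hn)), by ring⟩

/-- The term of index `N` in `truncSum N (-p / 4)`, up to a factor. -/
theorem last_term_cong (hp2 : p ≠ 2) {z : ℚ} (hz : z ∈ pIntegral p) (hz2 : z = -2 + p * z) :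
    PCong p 3 (z / 4 * (1 - p / 4 * z) * (1 + p ^ 2 / 4))
      (-1 / 2 - 3 / 4 * p - 9 / 8 * p ^ 2) := by
  have hp1 : (p : ℚ) ∈ pIntegral p := natCast_mem _ p
  have h0 : (-2 - 2 * p - 2 * p ^ 2 : ℚ) ∈ pIntegral p :=
    sub_mem (sub_mem (neg_mem (natCast_mem _ 2)) (mul_mem (natCast_mem _ 2) hp1))
      (mul_mem (natCast_mem _ 2) (pow_mem hp1 2))
  -- Iterating z = -2 + pz gives the truncated geometric series of 2/(p - 1).
  have h1 : PCong p 3 z (-2 - 2 * p - 2 * p ^ 2) :=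
    ⟨z, hz, by linear_combination (1 + p + p ^ 2 : ℚ) * hz2⟩
  have h2 := h1.mul hz h0 h1
  have h3 := ((h1.mul_left (inv_two_pow_mem hp2 2)).sub
    (h2.mul_left (mul_mem (inv_two_pow_mem hp2 4) hp1))).mul_left (c := 1 + p ^ 2 / 4)
    (add_mem (one_mem _) (div_four_mem hp2 (pow_mem hp1 2)))
  refine (h3.congr (w := (1 + p ^ 2 / 4) * (1 / 2 ^ 2 * (-2 - 2 * p - 2 * p ^ 2)
    - 1 / 2 ^ 4 * p * ((-2 - 2 * p - 2 * p ^ 2) * (-2 - 2 * p - 2 * p ^ 2)))) ?_).trans ?_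
  · ring
  · refine ⟨-((15 : ℕ) + (12 : ℕ) * p + (7 : ℕ) * p ^ 2 + (2 : ℕ) * p ^ 3 + p ^ 4) / 16, ?_, ?_⟩
    · exact div_sixteen_mem hp2 (neg_mem (add_mem (add_mem (add_mem (add_mem (natCast_mem _ 15)
        (mul_mem (natCast_mem _ 12) hp1)) (mul_mem (natCast_mem _ 7) (pow_mem hp1 2)))
        (mul_mem (natCast_mem _ 2) (pow_mem hp1 3))) (pow_mem hp1 4)))
    · push_cast
      ring

theorem truncSum_neg_cong (hN : p = 2 * N + 1) (hp5 : 5 ≤ p) :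
    PCong p 3 (truncSum N (-(p / 4))) (1 / 2 + p * harm N / 2) := by
  have hp2 : p ≠ 2 := by omega
  have hp1 : (p : ℚ) ∈ pIntegral p := natCast_mem _ p
  have hp0 : (p : ℚ) ≠ 0 := Nat.cast_ne_zero.mpr hp.out.ne_zero
  obtain ⟨n, rfl⟩ : ∃ n, N = n + 1 := ⟨N - 1, by omega⟩
  set z : ℚ := 1 / ((n : ℚ) + 1) with hz
  have hn0 : (n : ℚ) + 1 ≠ 0 := by positivity
  have hpn : (p : ℚ) = 2 * (n + 1) + 1 := by rw [hN]; push_cast; ring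
  have hzm : z ∈ pIntegral p := inv_succ_mem (by omega)
  have hz2 : z = -2 + p * z := by
    rw [hz, hpn]; field_simp; ring
  have hH : harm (n + 1) ∈ pIntegral p := harm_mem (by omega)
  have hHn : harm n = harm (n + 1) - z := by rw [harm_succ]; ring
  set H := harm (n + 1)
  have hS1 : PCong p 2 (harm n - 2 * oddHarm (n + 1) + 2) (2 * H + 4 + 2 * p) := by
    rw [hHn]
    have h1 : PCong p 2 z (-2 - 2 * p) := ⟨z, hzm, by linear_combination (1 + p : ℚ) * hz2⟩
    refine ((harm_half_cong hN hp5).neg.sub h1).congr ?_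
    ring
  have hSq : PCong p 1 (harmSq n) (-4) := by
    have h1 : PCong p 1 z (-2) := ⟨z, hzm, by linear_combination hz2⟩
    have h2 := h1.mul hzm (neg_mem (natCast_mem _ 2)) h1
    refine ((harmSq_half_cong hN hp5).sub h2).congr ?_
    rw [harmSq_succ]
    ring
  have hS2 : PCong p 1 (harmSq n - 2 * (harm n - 2 * oddHarm (n + 1) + 2)) (-12 - 4 * H) := by
    refine (hSq.sub ((hS1.mono (m := 1) (by norm_num)).mul_left (natCast_mem _ 2))).trans ?_
    exact ⟨-((4 : ℕ) : ℚ), neg_mem (natCast_mem _ 4), by push_cast; ring⟩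
  -- In the terms 0 < k < N the denominator 2k + 1 is prime to p; the explicit factor p means the
  -- remaining product is needed only mod p².
  have hmid : PCong p 3 (∑ k ∈ range n, chooseProd (k + 1) (-(p / 4)) * (1 / (2 * (k : ℚ) + 3)))
      (p * (1 / 2 ^ 2 * (2 * H + 4 + 2 * p)) - p * (p * (1 / 2 ^ 4 * (-12 - 4 * H)))) := by
    refine PCong.trans ?_ ((hS1.mul_left (inv_two_pow_mem hp2 2)).prime_mul.sub
      (hS2.mul_left (inv_two_pow_mem hp2 4)).prime_mul.prime_mul)
    rw [← sum_inv_sq_mul_odd, ← sum_inv_mul_odd, mul_sum, mul_sum, mul_sum, mul_sum, mul_sum,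
      ← sum_sub_distrib]
    refine PCong.sum fun k hk => ?_
    have hk' := mem_range.mp hk
    have hkm : 1 / ((k : ℚ) + 1) ∈ pIntegral p := inv_succ_mem (by omega)
    have hom : 1 / (2 * (k : ℚ) + 3) ∈ pIntegral p := by
      have := inv_odd_mem (p := p) (i := k + 1) (by omega)
      push_cast at this
      convert this using 2
      ring
    rw [chooseProd_succ_neg]
    have h1 := ((prod_one_sub_sq_cong_one hp2 (n := k) (by omega)).mul_left
      (c := 1 / ((k : ℚ) + 1) / 4 * (1 - p / 4 * (1 / ((k : ℚ) + 1))) * (1 / (2 * (k : ℚ) + 3)))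
      (mul_mem (mul_mem (div_four_mem hp2 hkm) (sub_mem (one_mem _)
        (mul_mem (div_four_mem hp2 hp1) hkm))) hom)).prime_mul
    refine h1.congr ?_
    ring
  -- At k = N the denominator 2N + 1 = p cancels the explicit factor p, so here the product is
  -- needed mod p³.
  have hlast : PCong p 3 (chooseProd (n + 1) (-(p / 4)) * (1 / (2 * ((n : ℚ) + 1) + 1)))
      (-1 / 2 - 3 / 4 * p - 9 / 8 * p ^ 2) := by
    have h1 : PCong p 3 (∏ i ∈ range n, (1 - ((p : ℚ) / 4) ^ 2 * (1 / ((i : ℚ) + 1)) ^ 2))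
        (1 + p ^ 2 / 4) := by
      refine (prod_one_sub_sq_cong hp2 (by omega)).trans ?_
      refine (hSq.mul_left (inv_two_pow_mem hp2 4)).prime_mul.prime_mul.neg.congr ?_
      ring
    have h2 := (h1.mul_left (c := z / 4 * (1 - p / 4 * z)) (mul_mem (div_four_mem hp2 hzm)
      (sub_mem (one_mem _) (mul_mem (div_four_mem hp2 hp1) hzm)))).trans
      (last_term_cong hp2 hzm hz2)
    rw [chooseProd_succ_neg, ← hpn, ← hz]
    refine h2.congr ?_
    field_simp
  have hsum : ∑ k ∈ range (n + 1 + 1), chooseProd k (-((p : ℚ) / 4)) * (1 / (2 * (k : ℚ) + 1))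
      = 1 + (∑ k ∈ range n, chooseProd (k + 1) (-(p / 4)) * (1 / (2 * (k : ℚ) + 3)))
        + chooseProd (n + 1) (-(p / 4)) * (1 / (2 * ((n : ℚ) + 1) + 1)) := by
    rw [sum_range_succ, sum_range_succ']
    have h0 : chooseProd 0 (-((p : ℚ) / 4)) = 1 := prod_range_zero _
    rw [h0]
    push_cast
    have : ∀ k : ℕ, 2 * ((k : ℚ) + 1) + 1 = 2 * k + 3 := fun k => by ring
    simp only [this]
    ring
  rw [truncSum, hsum]
  have htot := (((PCong.refl (1 : ℚ)).add hmid).add hlast).mul_left (c := 1 - p / 2)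
    (sub_mem (one_mem _) (div_two_mem hp2 hp1))
  refine PCong.trans (htot.congr (w := (1 - p / 2) * (1 +
    (p * (1 / 2 ^ 2 * (2 * H + 4 + 2 * p)) - p * (p * (1 / 2 ^ 4 * (-12 - 4 * H))))
      + (-1 / 2 - 3 / 4 * p - 9 / 8 * p ^ 2))) ?_) ?_
  · ring
  · refine ⟨-1 / 16 - H / 8, ?_, by ring⟩
    exact sub_mem (div_sixteen_mem hp2 (neg_mem (one_mem _))) (div_eight_mem hp2 hH)

theorem shiftTerm_cong (hN : p = 2 * N + 1) (hp5 : 5 ≤ p)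
    {j : ℕ} (hj : 2 * j + 1 < p) :
    PCong p 3 (shiftTerm N (-(p / 4) + j))
      (-(p / 2) * (1 / ((j : ℚ) + 1) + p / 4 * (1 / ((j : ℚ) + 1)) ^ 2
        + 2 * p * (1 / ((j : ℚ) + 1) * oddHarm (j + 1)))) := by
  have hp2 : p ≠ 2 := by omega
  have hp1 : (p : ℚ) ∈ pIntegral p := natCast_mem _ p
  have hpN : (p : ℚ) = 2 * N + 1 := by rw [hN]; push_cast; ring
  have hw0 : ∀ s : ℕ, ((4 * s + 2 - 3 * p : ℤ) : ℚ) ≠ 0 := by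
    intro s h
    have : (4 * s + 2 - 3 * p : ℤ) = 0 := by exact_mod_cast h
    omega
  -- By p = 2N + 1, the denominator is s + 1/2 - 3p/4; its reciprocal is 2/(2s + 1) mod p, which
  -- produces `oddHarm` below.
  have hw : ∀ s : ℕ, 1 / ((N : ℚ) + 1 + s - p / 4 - p)
      = 4 * (1 / ((4 * s + 2 - 3 * p : ℤ) : ℚ)) := by
    intro s
    have e : (N : ℚ) + 1 + s - p / 4 - p = ((4 * s + 2 - 3 * p : ℤ) : ℚ) / 4 := by
      push_cast
      linear_combination -hpN / 2
    rw [e]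
    have := hw0 s
    field_simp
  have hwm : ∀ s < j + 1, 1 / ((4 * s + 2 - 3 * p : ℤ) : ℚ) ∈ pIntegral p := by
    intro s hs
    refine inv_intCast_mem fun h => ?_
    have h1 : (p : ℤ) ∣ 2 * (2 * s + 1 : ℕ) := by
      have e : (2 * (2 * s + 1 : ℕ) : ℤ) = (4 * s + 2 - 3 * p) + 3 * p := by push_cast; ring
      rw [e]
      exact dvd_add h (dvd_mul_left _ _)
    have h2 : p ∣ 2 * (2 * s + 1) := by exact_mod_cast h1
    rcases (Nat.Prime.dvd_mul hp.out).mp h2 with h3 | h3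
    · exact absurd (Nat.le_of_dvd (by norm_num) h3) (by omega)
    · exact absurd (Nat.le_of_dvd (by omega) h3) (by omega)
  have hv0 : ((4 * (j + 1) - p : ℤ) : ℚ) ≠ 0 := by
    intro h
    have : (4 * (j + 1) - p : ℤ) = 0 := by exact_mod_cast h
    omega
  have hvm : 1 / ((4 * (j + 1) - p : ℤ) : ℚ) ∈ pIntegral p := by
    refine inv_intCast_mem fun h => ?_
    have h1 : (p : ℤ) ∣ (2 ^ 2 * (j + 1) : ℕ) := by
      have e : ((2 ^ 2 * (j + 1) : ℕ) : ℤ) = (4 * (j + 1) - p) + p := by push_cast; ring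
      rw [e]
      exact dvd_add h (dvd_refl _)
    rcases (Nat.Prime.dvd_mul hp.out).mp (Int.natCast_dvd_natCast.mp h1) with h3 | h3
    · exact absurd (Nat.le_of_dvd (by norm_num) (hp.out.dvd_of_dvd_pow h3)) (by omega)
    · exact absurd (Nat.le_of_dvd (by omega) h3) (by omega)
  have hv : (j : ℚ) + 1 - p / 4 = ((4 * (j + 1) - p : ℤ) : ℚ) / 4 := by push_cast; ring
  have hjm : 1 / ((j : ℚ) + 1) ∈ pIntegral p := inv_succ_mem (by omega)
  have hj0 : (j : ℚ) + 1 ≠ 0 := by positivity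
  set v := 1 / ((4 * (j + 1) - p : ℤ) : ℚ) with hvdef
  set W := ∏ s ∈ range (j + 1), (1 + (p : ℚ) * (1 / ((N : ℚ) + 1 + s - p / 4 - p))) with hW
  set A := ∏ i ∈ range N, (1 - ((p : ℚ) / 4) ^ 2 * (1 / ((i : ℚ) + 1)) ^ 2) with hA
  have hT : shiftTerm N (-(p / 4) + j) = -(p / 2) * (A * (4 * v) * W) := by
    have h := shiftTerm_eq (u := p / 4) hpN (j + 1) (fun s _ h => ?_) (fun s _ h => ?_)
    · rw [← hW, ← hA] at h
      push_cast at h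
      rw [hv, show -((p : ℚ) / 4) + (j + 1) - 1 = -(p / 4) + j by ring] at h
      rw [hvdef]
      generalize shiftTerm N (-((p : ℚ) / 4) + j) = t at h ⊢
      field_simp
      linear_combination 8 * h
    · have e : (N : ℚ) + 1 + s - p / 4 - p = ((4 * s + 2 - 3 * p : ℤ) : ℚ) / 4 := by
        push_cast
        linear_combination -hpN / 2
      rw [e] at h
      exact hw0 s (by linarith)
    · have e : ((4 * (s + 1) - p : ℤ) : ℚ) = 0 := by push_cast; linarith
      have : (4 * (s + 1) - p : ℤ) = 0 := by exact_mod_cast e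
      omega
  have hWc : PCong p 2 W (1 + p * (2 * oddHarm (j + 1))) := by
    refine (PCong.prod_one_add' (range (j + 1)) _ fun s hs => ?_).trans
      ((PCong.refl 1).add (PCong.prime_mul (n := 1) ?_))
    · rw [hw]
      exact mul_mem (natCast_mem _ 4) (hwm s (mem_range.mp hs))
    · rw [oddHarm, mul_sum]
      refine PCong.sum fun s hs => ?_
      have hs' := mem_range.mp hs
      have hom : 1 / (2 * (s : ℚ) + 1) ∈ pIntegral p := inv_odd_mem (by omega)
      rw [hw]
      refine ⟨((6 : ℕ) : ℚ) * (1 / ((4 * s + 2 - 3 * p : ℤ) : ℚ)) * (1 / (2 * (s : ℚ) + 1)),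
        mul_mem (mul_mem (natCast_mem _ 6) (hwm s hs')) hom, ?_⟩
      have h1 := hw0 s
      have h2 : 2 * (s : ℚ) + 1 ≠ 0 := by positivity
      field_simp
      push_cast
      ring
  have hvc : PCong p 2 (4 * v) (1 / ((j : ℚ) + 1) + p / 4 * (1 / ((j : ℚ) + 1)) ^ 2) := by
    refine ⟨v * (1 / ((j : ℚ) + 1)) ^ 2 / 4,
      div_four_mem hp2 (mul_mem hvm (pow_mem hjm 2)), ?_⟩
    rw [hvdef]
    field_simp
    push_cast
    ring
  have hAc := prod_one_sub_sq_cong_one hp2 (n := N) (by omega)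
  rw [← hA] at hAc
  have hAm : A ∈ pIntegral p := hAc.mem_iff.mpr (one_mem _)
  have hvm' : 4 * v ∈ pIntegral p := mul_mem (natCast_mem _ 4) hvm
  have hOm : oddHarm (j + 1) ∈ pIntegral p := oddHarm_mem (by omega)
  have hAv := hAc.mul hAm (hvc.mem_iff.mp hvm') hvc
  have hAvW := hAv.mul (mul_mem hAm hvm') (add_mem (one_mem _) (mul_mem hp1
    (mul_mem (natCast_mem _ 2) hOm))) hWc
  have hfin : PCong p 2 (A * (4 * v) * W) (1 / ((j : ℚ) + 1) + p / 4 * (1 / ((j : ℚ) + 1)) ^ 2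
        + 2 * p * (1 / ((j : ℚ) + 1) * oddHarm (j + 1))) := by
    refine hAvW.trans ⟨(1 / ((j : ℚ) + 1)) ^ 2 * oddHarm (j + 1) / 2,
      div_two_mem hp2 (mul_mem (pow_mem hjm 2) hOm), by ring⟩
  rw [hT]
  refine ((hfin.mul_left (neg_mem (inv_two_pow_mem hp2 1))).prime_mul).congr ?_
  ring

/-- The unknown `harmSq r` cancels between the shift terms and `harm_quarter_cong`. -/
theorem truncSum_cong (hN : p = 2 * N + 1) (hp5 : 5 ≤ p) (hr : N = 2 * r ∨ N = 2 * r + 1) :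
    PCong p 3 (truncSum N (-(p / 4) + r))
      ((1 + p * fermatQ p - p ^ 2 * fermatQ p ^ 2) / 2) := by
  have hp2 : p ≠ 2 := by omega
  have hp1 : (p : ℚ) ∈ pIntegral p := natCast_mem _ p
  have hsum : PCong p 3 (∑ j ∈ range r, shiftTerm N (-(p / 4) + j))
      (-(p / 2) * (harm r + p / 4 * harmSq r + 2 * p * oddHarmSum r)) := by
    rw [harm, harmSq, oddHarmSum, mul_sum, mul_sum, ← sum_add_distrib, ← sum_add_distrib, mul_sum]
    exact PCong.sum fun j hj => shiftTerm_cong hN hp5 (by have := mem_range.mp hj; omega)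
  have h1 := ((harm_half_cong_fermatQ hN hp5).mul_left (inv_two_pow_mem hp2 1)).prime_mul
  have h2 := ((harm_quarter_cong hN hp5 hr).mul_left (inv_two_pow_mem hp2 1)).prime_mul
  have h3 := (oddHarmSum_cong hN hp5 hr).prime_mul.prime_mul
  rw [truncSum_add_nat]
  refine (((((truncSum_neg_cong hN hp5).add hsum).add h1).sub h2).sub h3).congr ?_
  ring

end Final

theorem theorem2 (p : ℕ) (hp : p.Prime) (hp5 : 5 ≤ p) :
    RatModEq (p ^ 3)
      (∑ k ∈ Finset.range ((p - 1) / 2 + 1),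
        (((4 * k).choose (2 * k) : ℚ) * ((2 * k).choose k : ℚ)) /
          ((2 * (k : ℚ) + 1) * (64 : ℚ) ^ k))
      ((-1 : ℚ) ^ ((p - 1) / 2) *
        ((2 : ℚ) ^ (p - 1) - ((2 : ℚ) ^ (p - 1) - 1) ^ 2)) := by
  have : Fact p.Prime := ⟨hp⟩
  obtain ⟨N, hN⟩ : ∃ N, p = 2 * N + 1 := hp.odd_of_ne_two (by omega)
  obtain ⟨r, hr⟩ : ∃ r, N = 2 * r ∨ N = 2 * r + 1 := ⟨N / 2, by omega⟩
  apply PCong.toRatModEq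
  have h := (truncSum_cong hN hp5 hr).mul_left (c := ((2 : ℕ) : ℚ) * (-1) ^ N)
    (mul_mem (natCast_mem _ 2) (pow_mem (neg_mem (one_mem _)) N))
  have hsum : ∑ k ∈ range (N + 1), (((4 * k).choose (2 * k) : ℚ) * ((2 * k).choose k : ℚ)) /
      ((2 * (k : ℚ) + 1) * (64 : ℚ) ^ k)
      = ∑ k ∈ range (N + 1), chooseProd k (-1 / 4) * (1 / (2 * (k : ℚ) + 1)) := by
    refine sum_congr rfl fun k _ => ?_
    rw [chooseProd_neg_quarter]
    field_simp
  -- The prefactor 2x + 1 is 1/2 at x = -1/4 (N even) and -1/2 at x = -3/4 (N odd), that is (-1)^N /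
  -- 2.
  have hP : (2 : ℚ) * (-1) ^ N * truncSum N (-(p / 4) + r)
      = ∑ k ∈ range (N + 1), chooseProd k (-1 / 4) * (1 / (2 * (k : ℚ) + 1)) := by
    rcases hr with hr | hr
    · have e : -((p : ℚ) / 4) + r = -1 / 4 := by rw [hN, hr]; push_cast; ring
      rw [e, truncSum]
      nth_rw 1 [hr]
      rw [pow_mul]
      norm_num
      ring
    · have e : -((p : ℚ) / 4) + r = -3 / 4 := by rw [hN, hr]; push_cast; ring
      rw [e, truncSum]
      simp only [chooseProd_neg_three_quarters]
      nth_rw 1 [hr]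
      rw [pow_succ, pow_mul]
      norm_num
      ring
  rw [show (p - 1) / 2 = N by omega, hsum, ← hP, show p - 1 = 2 * N by omega,
    two_pow_eq_fermatQ hN]
  refine h.congr ?_
  push_cast
  ring
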